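/- **Setting.** Let $U:\mathbb R^d\to\mathbb R$ be differentiable with $\int e^{-U(x)}\,dx<\infty$, let $\pi$ be the probability measure on $\mathbb R^d$ with Lebesgue density proportional to $e^{-U}$, and let $H(x,p)=U(x)+\tfrac12\|p\|^2$ on $\mathbb R^d\times\mathbb R^d$. Let $\mathfrak L$ be a probability distribution on $\{0,1,2,\dots\}$ and let $\varepsilon\ge 0$. One iteration of Hamiltonian Monte Carlo (HMC) from $x$ draws independently $p\sim N(0,I)$, $L\sim\mathfrak L$ and $u\sim U[0,1]$, computes $(x',p')=\varphi_{L\varepsilon}(x,p)$, and moves to $x'$ if $\log u<H(x,p)-H(x',p')$, and otherwise stays at $x$. Here $\varphi_{L\varepsilon}$ is one of the following. - *Leapfrog integrator:* $\varphi_{L\varepsilon}$ is the $L$-fold iterate of the map $(x,p)\mapsto(x',p')$ given by $p_{1/2}=p-\tfrac{\varepsilon}{2}\nabla U(x)$, $x'=x+\varepsilon p_{1/2}$, $p'=p_{1/2}-\tfrac{\varepsilon}{2}\nabla U(x')$. - *Exact flow:* $U$ is continuously differentiable, Hamilton's equations $\dot x=p$, $\dot p=-\nabla U(x)$ have a unique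 solution $t\mapsto\varphi_t(x_0,p_0)$ on $\mathbb R$ for every initial value $(x_0,p_0)$, and $\varphi_{L\varepsilon}$ is this flow at time $L\varepsilon$. (A fixed integration time $T$ is the case $L=1$, $\varepsilon=T$.) Let $P$ be the transition kernel of the resulting Markov chain on $\mathbb R^d$. It is called geometrically ergodic if there are $\rho<1$ and a $\pi$-a.e. finite function $C:\mathbb R^d\to[0,\infty]$ such that $$\|P^n(x,\cdot)-\pi\|_{TV}:=\sup_{|f|\le 1}\left|\int f(y)\,P^n(x,dy)-\int f\,d\pi\right|\le C(x)\rho^n\qquad\text{for all } x\in\mathbb R^d \text{ and } n\ge 0 .$$ **Theorem.** Suppose that there is $M<\infty$ with $\|\nabla U(x)\|<M$ for all $x\in\mathbb R^d$. If the HMC chain with the leapfrog integrator is geometrically ergodic, then there is $s>0$ with $$\int e^{s\|x\|}\,\pi(dx)<\infty .$$ The same holds for the HMC chain with the exact flow. -/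

import Mathlib

open MeasureTheory ProbabilityTheory
open scoped ENNReal NNReal

noncomputable section

namespace HMC

/-- The state space `ℝ^d` with the Euclidean norm. -/
abbrev Space (d : ℕ) : Type := EuclideanSpace ℝ (Fin d)

/-- Phase space: pairs `(x, p)` of a position and a momentum. -/
abbrev Phase (d : ℕ) : Type := Space d × Space d

variable {d : ℕ}

/-- The probability measure with Lebesgue density `e^{-U(x)} / ∫ e^{-U}`. -/
def target (U : Space d → ℝ) : Measure (Space d) :=
  (volume : Measure (Space d)).tilted (fun x => -U x)

/-- The Hamiltonian `H(x, p) = U(x) + ‖p‖² / 2` (unit mass matrix). -/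
def hamiltonian (U : Space d → ℝ) (z : Phase d) : ℝ :=
  U z.1 + ‖z.2‖ ^ 2 / 2

/-! ### Integrators -/

/-- One step of the leapfrog (Störmer–Verlet) scheme with step size `ε`. -/
def leapfrogStep (U : Space d → ℝ) (ε : ℝ) (z : Phase d) : Phase d :=
  let pHalf := z.2 - (ε / 2) • gradient U z.1
  let x' := z.1 + ε • pHalf
  (x', pHalf - (ε / 2) • gradient U x')

/-- `L` steps of the leapfrog scheme with step size `ε`. -/
def leapfrog (U : Space d → ℝ) (ε : ℝ) (L : ℕ) : Phase d → Phase d :=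
  (leapfrogStep U ε)^[L]

/-- The curve `γ = (x, p)` solves Hamilton's equations `x' = p`, `p' = -∇U(x)` at all times. -/
def SolvesHamilton (U : Space d → ℝ) (γ : ℝ → Phase d) : Prop :=
  ∀ t, HasDerivAt (fun s => (γ s).1) (γ t).2 t ∧
    HasDerivAt (fun s => (γ s).2) (-gradient U (γ t).1) t

/-- `φ` is the Hamiltonian flow: `t ↦ φ t z` is the solution of Hamilton's equations which starts
at `z`. -/
structure IsHamiltonianFlow (U : Space d → ℝ) (φ : ℝ → Phase d → Phase d) : Prop where
  init : ∀ z, φ 0 z = z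
  solves : ∀ z, SolvesHamilton U (fun t => φ t z)
  unique : ∀ γ, SolvesHamilton U γ → ∀ t, γ t = φ t (γ 0)

/-! ### The Hamiltonian Monte Carlo chain -/

/-- One iteration of Hamiltonian Monte Carlo from `x`, when the momentum `p`, the number of steps
`L` and the uniform variable `u` have been drawn; `Φ L` is the map which integrates Hamilton's
equations (exactly or approximately) for `L` steps. -/
def hmcStep (U : Space d → ℝ) (Φ : ℕ → Phase d → Phase d) (x : Space d)
    (θ : Space d × ℕ × ℝ) : Space d :=
  let p := θ.1
  let L := θ.2.1
  let u := θ.2.2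
  open Classical in
  if Real.log u < hamiltonian U (x, p) - hamiltonian U (Φ L (x, p)) then (Φ L (x, p)).1 else x

/-- The joint law of the independent draws `p ∼ N(0, I)`, `L ∼ 𝔏`, `u ∼ U[0, 1]`. -/
def drawLaw (d : ℕ) (𝔏 : Measure ℕ) : Measure (Space d × ℕ × ℝ) :=
  (stdGaussian (Space d)).prod (𝔏.prod (volume.restrict (Set.Icc (0 : ℝ) 1)))

/-- The transition kernel of the chain: `P(x, ·)` is the law of `hmcStep U Φ x (p, L, u)`
(see `hmcKernel_apply`). -/
def hmcKernel (U : Space d → ℝ) (Φ : ℕ → Phase d → Phase d) (𝔏 : Measure ℕ) :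
    Kernel (Space d) (Space d) :=
  (Kernel.id ×ₖ Kernel.const (Space d) (drawLaw d 𝔏)).map
    (fun q => hmcStep U Φ q.1 q.2)

/-! ### Geometric ergodicity -/

/-- Total variation distance `sup_{|f| ≤ 1} |E_μ f - E_ν f|` (with values in `[0, 2]` for
probability measures). -/
def tvDist {X : Type*} [MeasurableSpace X] (μ ν : Measure X) : ℝ≥0∞ :=
  ⨆ (f : X → ℝ) (_ : Measurable f) (_ : ∀ x, |f x| ≤ 1),
    ENNReal.ofReal |∫ x, f x ∂μ - ∫ x, f x ∂ν|

/-- `P` is geometrically ergodic with limiting distribution `π`: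
`‖Pⁿ(x, ·) - π‖_TV ≤ M(x) ρⁿ` for some `ρ < 1` and some `π`-a.e. finite `M : X → [0, ∞]`. -/
def IsGeometricallyErgodic {X : Type*} [MeasurableSpace X] (P : Kernel X X) (π : Measure X) :
    Prop :=
  ∃ (ρ : ℝ≥0) (M : X → ℝ≥0∞), ρ < 1 ∧ (∀ᵐ x ∂π, M x < ∞) ∧
    ∀ x n, tvDist ((P ^ n) x) π ≤ M x * (ρ : ℝ≥0∞) ^ n

/-! ### The kernels are genuine Markov kernels -/

instance isProbabilityMeasure_drawLaw (𝔏 : Measure ℕ) [IsProbabilityMeasure 𝔏] :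
    IsProbabilityMeasure (drawLaw d 𝔏) := by
  have : IsProbabilityMeasure ((volume : Measure ℝ).restrict (Set.Icc (0 : ℝ) 1)) :=
    ⟨by simp⟩
  unfold drawLaw
  infer_instance

theorem measurable_gradient (U : Space d → ℝ) : Measurable (gradient U) := by
  unfold gradient
  exact (LinearIsometryEquiv.continuous _).measurable.comp (measurable_fderiv ℝ U)

theorem measurable_leapfrogStep (U : Space d → ℝ) (ε : ℝ) : Measurable (leapfrogStep U ε) := by
  have hg := measurable_gradient U
  unfold leapfrogStep
  fun_prop

theorem measurable_leapfrog (U : Space d → ℝ) (ε : ℝ) (L : ℕ) : Measurable (leapfrog U ε L) :=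
  (measurable_leapfrogStep U ε).iterate L

theorem measurable_hmcStep {U : Space d → ℝ} (hU : Measurable U) {Φ : ℕ → Phase d → Phase d}
    (hΦ : ∀ L, Measurable (Φ L)) :
    Measurable (fun q : Space d × Space d × ℕ × ℝ => hmcStep U Φ q.1 q.2) := by
  have hΦ' : Measurable (fun q : Space d × Space d × ℕ × ℝ => Φ q.2.2.1 (q.1, q.2.1)) := by
    have h : Measurable (fun r : Phase d × ℕ => Φ r.2 r.1) :=
      measurable_from_prod_countable_left hΦ
    exact h.comp (f := fun q : Space d × Space d × ℕ × ℝ => ((q.1, q.2.1), q.2.2.1))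
      (by fun_prop)
  have hH : Measurable (hamiltonian U) := by
    unfold hamiltonian
    fun_prop
  unfold hmcStep
  refine Measurable.ite (measurableSet_lt ?_ ?_) hΦ'.fst measurable_fst
  · exact Real.measurable_log.comp (by fun_prop)
  · exact (hH.comp (by fun_prop)).sub (hH.comp hΦ')

theorem hmcKernel_apply {U : Space d → ℝ} (hU : Measurable U) {Φ : ℕ → Phase d → Phase d}
    (hΦ : ∀ L, Measurable (Φ L)) (𝔏 : Measure ℕ) [IsProbabilityMeasure 𝔏] (x : Space d) :
    hmcKernel U Φ 𝔏 x = (drawLaw d 𝔏).map (hmcStep U Φ x) := by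
  have h := measurable_hmcStep hU hΦ
  rw [hmcKernel, Kernel.map_apply _ h, Kernel.prod_apply, Kernel.id_apply, Kernel.const_apply,
    Measure.dirac_prod, Measure.map_map h (by fun_prop)]
  rfl

theorem isMarkovKernel_hmcKernel {U : Space d → ℝ} (hU : Measurable U)
    {Φ : ℕ → Phase d → Phase d} (hΦ : ∀ L, Measurable (Φ L)) (𝔏 : Measure ℕ)
    [IsProbabilityMeasure 𝔏] : IsMarkovKernel (hmcKernel U Φ 𝔏) := by
  unfold hmcKernel
  exact Kernel.IsMarkovKernel.map _ (measurable_hmcStep hU hΦ)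

end HMC

end

noncomputable section

namespace HMC

/-! ### Avoiding a set: the survival function and its last-visit decomposition -/

section Survival

/-! Two rates of escape are compared. Because the gradient is bounded, one HMC move from `x` has
length at most a function of the draws alone, so the increments of the chain are tight uniformly in
`x` (`hasTightIncrements_hmcKernel`). The same is true of every skeleton `Q = P ^ N`. Hence a chain
started beyond `R + n * K` avoids a set `S` inside the ball of radius `R` for `n` steps with
probability at least `q ^ n`, where `q` can be brought as near 1 as desired by enlarging `K`
(`survival_ge_of_tight`).

Geometric ergodicity gives an upper bound. Take `S` bounded, of positive mass, on which the
convergence constant is essentially bounded. For large `N` the chain `Q` is almost stationary one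
step after leaving a point of `S`, so its visits to `S` nearly form a renewal process, and the
stationary probability of avoiding `S` for `n` steps is at most `(1 - π(S) / 2) ^ n`
(`integral_survival_le`).

The choice `q = 1 - π(S) / 4` makes the ratio of the two rates less than 1. The tail of `π` beyond
`R + n * K` is then geometric in `n`, which is an exponential moment. It is essential that `N`, and
with it the rate of the upper bound, is fixed before `K`. -/

theorem abs_indicator_le {X : Type*} {f : X → ℝ} {t : ℝ} (h : ∀ x, |f x| ≤ t) (A : Set X) (x : X) :
    |A.indicator f x| ≤ t :=
  (norm_indicator_le_norm_self f x).trans (h x)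

variable {X : Type*} [MeasurableSpace X]

theorem isMarkovKernel_pow (Q : Kernel X X) [IsMarkovKernel Q] :
    ∀ n : ℕ, IsMarkovKernel (Q ^ n)
  | 0 => by rw [pow_zero]; exact inferInstanceAs (IsMarkovKernel Kernel.id)
  | n + 1 => by
    have := isMarkovKernel_pow Q n
    rw [pow_succ]
    exact inferInstanceAs (IsMarkovKernel ((Q ^ n) ∘ₖ Q))

theorem invariant_pow {Q : Kernel X X} {π : Measure X} (hπ : Q.Invariant π) :
    ∀ n : ℕ, (Q ^ n).Invariant π
  | 0 => by rw [pow_zero]; exact Measure.bind_dirac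
  | n + 1 => by rw [pow_succ]; exact (invariant_pow hπ n).comp hπ

theorem integrable_of_abs_le {μ : Measure X} [IsFiniteMeasure μ] {f : X → ℝ} (hf : Measurable f)
    {t : ℝ} (ht : ∀ x, |f x| ≤ t) : Integrable f μ :=
  Integrable.of_bound hf.aestronglyMeasurable t (ae_of_all _ ht)

theorem abs_integral_le_of_abs_le {μ : Measure X} [IsProbabilityMeasure μ] {f : X → ℝ}
    {t : ℝ} (ht : ∀ x, |f x| ≤ t) : |∫ x, f x ∂μ| ≤ t := by
  simpa using norm_integral_le_of_norm_le_const (μ := μ) (f := f) (ae_of_all _ ht)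

theorem measurable_integral_kernel (Q : Kernel X X) [IsMarkovKernel Q] {f : X → ℝ}
    (hf : Measurable f) : Measurable (fun x => ∫ y, f y ∂(Q x)) :=
  (StronglyMeasurable.integral_kernel hf.stronglyMeasurable).measurable

theorem integral_pow_succ (Q : Kernel X X) [IsMarkovKernel Q] {f : X → ℝ} (hf : Measurable f)
    {t : ℝ} (ht : ∀ x, |f x| ≤ t) (n : ℕ) (x : X) :
    ∫ y, f y ∂((Q ^ (n + 1)) x) = ∫ z, ∫ y, f y ∂((Q ^ n) z) ∂(Q x) := by
  have := isMarkovKernel_pow Q (n + 1)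
  have h := integrable_of_abs_le (μ := (Q ^ (n + 1)) x) hf ht
  rw [pow_succ] at h ⊢
  exact Kernel.integral_comp h

theorem integral_integral_of_invariant {Q : Kernel X X} [IsMarkovKernel Q] {π : Measure X}
    [IsProbabilityMeasure π] (hπ : Q.Invariant π) {f : X → ℝ} (hf : Measurable f)
    {t : ℝ} (ht : ∀ x, |f x| ≤ t) :
    ∫ x, ∫ y, f y ∂(Q x) ∂π = ∫ x, f x ∂π := by
  have h := integrable_of_abs_le (μ := π.bind Q) hf ht
  conv_rhs => rw [← hπ.def]
  rw [Measure.comp_eq_comp_const_apply] at h ⊢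
  rw [Kernel.integral_comp h, Kernel.const_apply]

/-- `survival Q S n x` is the probability that the chain started at `x` avoids `S` at the times
`1, …, n`. -/
def survival (Q : Kernel X X) (S : Set X) : ℕ → X → ℝ
  | 0 => fun _ => 1
  | n + 1 => fun x => ∫ y, Sᶜ.indicator (survival Q S n) y ∂(Q x)

variable {Q : Kernel X X} {S : Set X}

theorem survival_nonneg : ∀ n x, 0 ≤ survival Q S n x
  | 0, _ => zero_le_one
  | n + 1, _ => integral_nonneg fun _ => Set.indicator_nonneg (fun _ _ => survival_nonneg n _) _

/-- By invariance a `π`-null set is also null for `Q x`, for almost every `x`. This permits changing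
test functions on null sets. -/
theorem ae_integral_kernel_congr {π : Measure X} (hπ : Q.Invariant π) {f g : X → ℝ}
    (h : f =ᵐ[π] g) : ∀ᵐ x ∂π, ∫ y, f y ∂(Q x) = ∫ y, g y ∂(Q x) := by
  rw [← hπ.def] at h
  filter_upwards [Measure.ae_ae_of_ae_comp h] with x hx using integral_congr_ae hx

variable [IsMarkovKernel Q]

theorem measurable_survival (hS : MeasurableSet S) : ∀ n, Measurable (survival Q S n)
  | 0 => measurable_const
  | n + 1 => measurable_integral_kernel Q ((measurable_survival hS n).indicator hS.compl)

theorem abs_survival_le_one : ∀ n x, |survival Q S n x| ≤ 1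
  | 0, _ => by simp [survival]
  | n + 1, _ => abs_integral_le_of_abs_le (abs_indicator_le (abs_survival_le_one n) _)

theorem integral_indicator_compl {μ : Measure X} [IsFiniteMeasure μ] (hS : MeasurableSet S)
    {f : X → ℝ} (hf : Measurable f) {t : ℝ} (ht : ∀ x, |f x| ≤ t) :
    ∫ x, Sᶜ.indicator f x ∂μ = ∫ x, f x ∂μ - ∫ x, S.indicator f x ∂μ := by
  have h := integrable_of_abs_le (μ := μ) hf ht
  rw [integral_indicator hS.compl, integral_indicator hS, ← integral_add_compl hS h]
  ring

/-- Decomposition of the path according to its last visit to `S`. -/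
theorem survival_add_sum (hS : MeasurableSet S) : ∀ n x, survival Q S n x +
    ∑ k ∈ Finset.range n, ∫ y, S.indicator (survival Q S (n - 1 - k)) y ∂((Q ^ (k + 1)) x) = 1
  | 0, _ => by simp [survival]
  | n + 1, x => by
    have hm (j : ℕ) : Measurable (S.indicator (survival Q S j)) :=
      (measurable_survival hS j).indicator hS
    have hb (j : ℕ) := abs_indicator_le (abs_survival_le_one (Q := Q) (S := S) j) S
    have ih : survival Q S n = fun y => 1 - ∑ k ∈ Finset.range n,
        ∫ z, S.indicator (survival Q S (n - 1 - k)) z ∂((Q ^ (k + 1)) y) := by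
      funext y
      linarith [survival_add_sum hS n y]
    have hi (j k : ℕ) : Integrable (fun y =>
        ∫ z, S.indicator (survival Q S j) z ∂((Q ^ k) y)) (Q x) := by
      have := isMarkovKernel_pow Q k
      exact integrable_of_abs_le (measurable_integral_kernel _ (hm j))
        fun y => abs_integral_le_of_abs_le (hb j)
    have hn : ∫ y, survival Q S n y ∂(Q x) = 1 - ∑ k ∈ Finset.range n,
        ∫ y, S.indicator (survival Q S (n - 1 - k)) y ∂((Q ^ (k + 1 + 1)) x) := by
      conv_lhs => rw [ih]
      rw [integral_sub (integrable_const _) (integrable_finsetSum _ fun k _ => hi _ _),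
        integral_finsetSum _ fun k _ => hi _ _]
      simp [integral_pow_succ Q (hm _) (hb _) (_ + 1)]
    -- The integral over `S` removed here is the term `k = 0`, a last visit at time 1. The induction
    -- hypothesis supplies the later visits, shifted by one step.
    rw [Finset.sum_range_succ', show survival Q S (n + 1) x =
        ∫ y, Sᶜ.indicator (survival Q S n) y ∂(Q x) from rfl,
      integral_indicator_compl hS (measurable_survival hS n) (abs_survival_le_one n), hn]
    have he (k : ℕ) : n + 1 - 1 - (k + 1) = n - 1 - k := by omega
    simp only [he]
    simp

theorem integral_survival_succ {π : Measure X} [IsProbabilityMeasure π] (hπ : Q.Invariant π)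
    (hS : MeasurableSet S) (n : ℕ) : ∫ x, survival Q S (n + 1) x ∂π =
      ∫ x, survival Q S n x ∂π - ∫ x, S.indicator (survival Q S n) x ∂π := by
  rw [← integral_indicator_compl hS (measurable_survival hS n) (abs_survival_le_one n),
    ← integral_integral_of_invariant hπ ((measurable_survival hS n).indicator hS.compl)
      (abs_indicator_le (abs_survival_le_one n) _)]
  rfl

/-- The stationary counterpart of `survival_add_sum`. Subtracting the two leaves only differences
between `Q ^ (k + 1)` and `π`, which ergodicity controls. -/
theorem integral_survival_eq {π : Measure X} [IsProbabilityMeasure π] (hπ : Q.Invariant π)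
    (hS : MeasurableSet S) : ∀ n, ∫ x, survival Q S n x ∂π = 1 -
      ∑ k ∈ Finset.range n, ∫ x, S.indicator (survival Q S (n - 1 - k)) x ∂π
  | 0 => by simp [survival]
  | n + 1 => by
    have he (k : ℕ) : n + 1 - 1 - (k + 1) = n - 1 - k := by omega
    rw [integral_survival_succ hπ hS, integral_survival_eq hπ hS n, Finset.sum_range_succ']
    simp only [he]
    simp
    ring

/-! ### Renewal recursion and the geometric tail of the entrance time -/

/-- The error sequence of the perturbed renewal recursion with main terms `c`. -/
def renewalError (η θ : ℝ) (c : ℕ → ℝ) : ℕ → ℝ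
  | 0 => 0
  | n + 1 => η * (c n + renewalError η θ c n) + θ * renewalError η θ c n

/-- The unrolled form is the one that the last-visit decomposition produces; the recursive form is
the one used for the decay estimate. -/
theorem renewalError_eq_sum (η θ : ℝ) (c : ℕ → ℝ) : ∀ n, renewalError η θ c n =
    ∑ k ∈ Finset.range n, η * θ ^ k * (c (n - 1 - k) + renewalError η θ c (n - 1 - k))
  | 0 => rfl
  | n + 1 => by
    have he (k : ℕ) : n + 1 - 1 - (k + 1) = n - 1 - k := by omega
    rw [Finset.sum_range_succ', renewalError]
    conv_lhs => rw [renewalError_eq_sum η θ c n]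
    simp only [he, Finset.mul_sum]
    rw [← renewalError_eq_sum η θ c n, add_comm]
    congr 1
    · exact Finset.sum_congr rfl fun k _ => by ring
    · simp

theorem renewalError_nonneg {η θ : ℝ} (hη : 0 ≤ η) (hθ : 0 ≤ θ) {c : ℕ → ℝ} (hc : ∀ n, 0 ≤ c n) :
    ∀ n, 0 ≤ renewalError η θ c n
  | 0 => le_rfl
  | n + 1 => by
    have := renewalError_nonneg hη hθ hc n
    have := hc n
    rw [renewalError]
    positivity

/-- The combination `c + 4 * e` is a Lyapunov function: one step multiplies `c` by at most `1 - s +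
4 * η ≤ 1 - s / 2`, and `e` by at most `s + 4 * (η + θ) ≤ 1 + s`, which is within `4 * (1 - s / 2)`
since `s ≤ 1`. -/
theorem renewal_geometric_bound {η θ s : ℝ} {c : ℕ → ℝ} (hs0 : 0 ≤ s) (hs1 : s ≤ 1) (hη : 0 ≤ η)
    (hθ : 0 ≤ θ) (hηs : 8 * η ≤ s) (hηθ : 4 * (η + θ) ≤ 1) (hc : ∀ n, 0 ≤ c n) (hc0 : c 0 = 1)
    (hrec : ∀ n, c (n + 1) ≤ c n - s * (c n - renewalError η θ c n)) :
    ∀ n, c n + 4 * renewalError η θ c n ≤ (1 - s / 2) ^ n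
  | 0 => by simp [renewalError, hc0]
  | n + 1 => by
    have ih := renewal_geometric_bound hs0 hs1 hη hθ hηs hηθ hc hc0 hrec n
    have he := renewalError_nonneg hη hθ hc n
    have hr := hrec n
    have hcn := hc n
    rw [pow_succ, renewalError]
    have h := mul_le_mul_of_nonneg_right ih (by linarith : 0 ≤ 1 - s / 2)
    nlinarith [mul_nonneg hcn (by linarith : 0 ≤ s - 8 * η),
      mul_nonneg he (by linarith : 0 ≤ 1 - 4 * (η + θ)), mul_nonneg he (by linarith : 0 ≤ 1 - s)]

/-- If the chain converges geometrically to `π`, with small constants, from almost every point of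
`S`, then the time at which the stationary chain enters `S` has a geometric tail. -/
theorem integral_survival_le {π : Measure X} [IsProbabilityMeasure π] (hπ : Q.Invariant π)
    (hS : MeasurableSet S) {η θ : ℝ} (hη : 0 ≤ η) (hθ : 0 ≤ θ) (hηs : 8 * η ≤ π.real S)
    (hηθ : 4 * (η + θ) ≤ 1)
    (hconv : ∀ (f : X → ℝ) (t : ℝ), Measurable f → (∀ x, |f x| ≤ t) → ∀ k : ℕ,
      ∀ᵐ x ∂π, x ∈ S → |∫ y, f y ∂((Q ^ (k + 1)) x) - ∫ y, f y ∂π| ≤ η * θ ^ k * t) (n : ℕ) :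
    ∫ x, survival Q S n x ∂π ≤ (1 - π.real S / 2) ^ n := by
  set c : ℕ → ℝ := fun n => ∫ x, survival Q S n x ∂π with hcdef
  have hc (n : ℕ) : 0 ≤ c n := integral_nonneg fun x => survival_nonneg n x
  set e := renewalError η θ c with hedef
  have he (n : ℕ) : 0 ≤ e n := renewalError_nonneg hη hθ hc n
  have key : ∀ n, ∀ᵐ x ∂π, x ∈ S → |survival Q S n x - c n| ≤ e n := by
    intro n
    induction n using Nat.strong_induction_on with
    | _ n ih =>
    have hterm : ∀ k ∈ Finset.range n, ∀ᵐ x ∂π, x ∈ S →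
        |∫ y, S.indicator (survival Q S (n - 1 - k)) y ∂((Q ^ (k + 1)) x) -
          ∫ y, S.indicator (survival Q S (n - 1 - k)) y ∂π|
          ≤ η * θ ^ k * (c (n - 1 - k) + e (n - 1 - k)) := by
      intro k hk
      have hk' := Finset.mem_range.1 hk
      set j := n - 1 - k
      have := isMarkovKernel_pow Q (k + 1)
      -- The bound `c j + e j` for the survival function on `S` holds only almost everywhere,
      -- whereas `hconv` asks for it everywhere; hence the truncation.
      set g : X → ℝ := S.indicator (fun x => min (survival Q S j x) (c j + e j)) with hg
      have hgm : Measurable g :=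
        ((measurable_survival hS j).min measurable_const).indicator hS
      have hgb : ∀ x, |g x| ≤ c j + e j := by
        refine fun x => abs_indicator_le (fun x => ?_) S x
        rw [abs_of_nonneg (le_min (survival_nonneg j x) (add_nonneg (hc j) (he j)))]
        exact min_le_right _ _
      have hfg : S.indicator (survival Q S j) =ᵐ[π] g := by
        filter_upwards [ih j (by omega)] with x hx
        by_cases hxS : x ∈ S
        · have := (abs_le.1 (hx hxS)).2
          simp only [hg, Set.indicator_of_mem hxS]
          rw [min_eq_left (by linarith)]
        · simp [hg, hxS]
      filter_upwards [hconv g _ hgm hgb k, ae_integral_kernel_congr (invariant_pow hπ (k + 1)) hfg]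
        with x hx hx' hxS
      rw [hx', integral_congr_ae hfg]
      exact hx hxS
    have hall := (ae_ball_iff (Finset.range n).countable_toSet).2 hterm
    filter_upwards [hall] with x hx hxS
    have h1 := survival_add_sum (Q := Q) hS n x
    have h2 : c n = _ := integral_survival_eq hπ hS n
    have h3 : survival Q S n x - c n = -∑ k ∈ Finset.range n,
        (∫ y, S.indicator (survival Q S (n - 1 - k)) y ∂((Q ^ (k + 1)) x) -
          ∫ y, S.indicator (survival Q S (n - 1 - k)) y ∂π) := by
      rw [Finset.sum_sub_distrib]
      linarith
    rw [h3, abs_neg, hedef, renewalError_eq_sum]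
    exact (Finset.abs_sum_le_sum_abs _ _).trans (Finset.sum_le_sum fun k hk => hx k hk hxS)
  -- The loss from `c n` to `c (n + 1)` is the integral of the survival function over `S`, where it
  -- is at least `c n - e n`.
  have hrec (n : ℕ) : c (n + 1) ≤ c n - π.real S * (c n - e n) := by
    rw [show c (n + 1) = _ from integral_survival_succ hπ hS n]
    have hle : ∫ x, S.indicator (fun _ => c n - e n) x ∂π ≤
        ∫ x, S.indicator (survival Q S n) x ∂π := by
      refine integral_mono_ae ((integrable_const _).indicator hS)
        (integrable_of_abs_le ((measurable_survival hS n).indicator hS)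
          (abs_indicator_le (abs_survival_le_one n) _)) ?_
      filter_upwards [key n] with x hx
      by_cases hxS : x ∈ S
      · have := (abs_le.1 (hx hxS)).1
        simp only [Set.indicator_of_mem hxS]
        linarith
      · simp [hxS]
    rw [integral_indicator_const _ hS, smul_eq_mul] at hle
    linarith
  have h := renewal_geometric_bound measureReal_nonneg measureReal_le_one hη hθ hηs hηθ hc
    (by simp [hcdef, survival]) hrec n
  have := he n
  linarith

end Survival

/-! ### Consequences of geometric convergence in total variation -/

section GeometricErgodicity

variable {X : Type*} [MeasurableSpace X]

theorem abs_integral_sub_le_of_tvDist_le {μ ν : Measure X} {a t : ℝ} (ha : 0 ≤ a)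
    (h : tvDist μ ν ≤ ENNReal.ofReal a) {f : X → ℝ} (hf : Measurable f) (ht0 : 0 ≤ t)
    (ht : ∀ x, |f x| ≤ t) : |∫ x, f x ∂μ - ∫ x, f x ∂ν| ≤ a * t := by
  rcases ht0.eq_or_lt with rfl | ht0
  · have hf0 (x : X) : f x = 0 := abs_nonpos_iff.1 (ht x)
    simp [hf0]
  · have hb (x : X) : |f x / t| ≤ 1 := by
      rw [abs_div, abs_of_pos ht0, div_le_one ht0]
      exact ht x
    have h1 : ENNReal.ofReal |∫ x, f x / t ∂μ - ∫ x, f x / t ∂ν| ≤ ENNReal.ofReal a :=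
      (le_iSup₂_of_le (fun x => f x / t) (hf.div_const t)
        (le_iSup (fun _ : ∀ x, |f x / t| ≤ 1 => ENNReal.ofReal _) hb)).trans h
    rw [ENNReal.ofReal_le_ofReal_iff ha, integral_div, integral_div, ← sub_div, abs_div,
      abs_of_pos ht0, div_le_iff₀ ht0] at h1
    exact h1

theorem tvDist_le_ofReal {P : Kernel X X} {π : Measure X} {ρ : ℝ≥0} {M : X → ℝ≥0∞}
    (hgeo : ∀ x n, tvDist ((P ^ n) x) π ≤ M x * (ρ : ℝ≥0∞) ^ n) {x : X} {c : ℝ≥0}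
    (hc : M x ≤ c) (n : ℕ) : tvDist ((P ^ n) x) π ≤ ENNReal.ofReal (c * (ρ : ℝ) ^ n) := by
  refine (hgeo x n).trans ?_
  rw [show (c : ℝ) * (ρ : ℝ) ^ n = ((c * ρ ^ n : ℝ≥0) : ℝ) by push_cast; rfl,
    ENNReal.ofReal_coe_nnreal, ENNReal.coe_mul, ENNReal.coe_pow]
  gcongr

/-- From one point with finite constant, `P ^ (n + 1)` applied to an indicator converges to its
`π`-integral, and also, read as `P ^ n` applied to the image of the indicator under `P`, to the
integral against `π.bind P`. -/
theorem invariant_of_geometric {P : Kernel X X} [IsMarkovKernel P] {π : Measure X}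
    [IsProbabilityMeasure π] {ρ : ℝ≥0} {M : X → ℝ≥0∞} (hρ : ρ < 1) (hM : ∀ᵐ x ∂π, M x < ∞)
    (hgeo : ∀ x n, tvDist ((P ^ n) x) π ≤ M x * (ρ : ℝ≥0∞) ^ n) : P.Invariant π := by
  obtain ⟨x, hx⟩ := hM.exists
  have hc : M x ≤ (M x).toNNReal := (ENNReal.coe_toNNReal hx.ne).ge
  set c := (M x).toNNReal
  have hlim {f : X → ℝ} (hf : Measurable f) (hb : ∀ y, |f y| ≤ 1) :
      Filter.Tendsto (fun n => ∫ y, f y ∂((P ^ n) x)) Filter.atTop (nhds (∫ y, f y ∂π)) := by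
    rw [tendsto_iff_norm_sub_tendsto_zero]
    refine squeeze_zero (fun _ => norm_nonneg _) (fun n =>
      abs_integral_sub_le_of_tvDist_le (by positivity) (tvDist_le_ofReal hgeo hc n) hf
        zero_le_one hb) ?_
    simpa using (tendsto_pow_atTop_nhds_zero_of_lt_one ρ.coe_nonneg
      (by exact_mod_cast hρ)).const_mul (c : ℝ)
  ext A hA
  have hf : Measurable (A.indicator (1 : X → ℝ)) := measurable_one.indicator hA
  have hb : ∀ y, |A.indicator (1 : X → ℝ) y| ≤ 1 := abs_indicator_le (by simp) A
  have hstep (n : ℕ) : ∫ y, A.indicator (1 : X → ℝ) y ∂((P ^ (n + 1)) x) =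
      ∫ z, ∫ y, A.indicator (1 : X → ℝ) y ∂(P z) ∂((P ^ n) x) := by
    have := isMarkovKernel_pow P (n + 1)
    have h := integrable_of_abs_le (μ := (P ^ (n + 1)) x) hf hb
    rw [pow_succ'] at h ⊢
    exact Kernel.integral_comp h
  have h1 := (hlim hf hb).comp (Filter.tendsto_add_atTop_nat 1)
  have h2 := hlim (measurable_integral_kernel P hf) fun y => abs_integral_le_of_abs_le hb
  have h3 := tendsto_nhds_unique (h1.congr fun n => hstep n) h2
  have h4 : ∫ y, A.indicator (1 : X → ℝ) y ∂(π.bind P) =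
      ∫ z, ∫ y, A.indicator (1 : X → ℝ) y ∂(P z) ∂π := by
    have h := integrable_of_abs_le (μ := π.bind P) hf hb
    rw [Measure.comp_eq_comp_const_apply] at h ⊢
    rw [Kernel.integral_comp h, Kernel.const_apply]
  rw [← h3, integral_indicator_one hA, integral_indicator_one hA] at h4
  exact (measureReal_eq_measureReal_iff).1 h4

end GeometricErgodicity

/-! ### Tight increments and exponential moments -/

section ExponentialMoment

variable {E : Type*} [NormedAddCommGroup E] [MeasurableSpace E] [BorelSpace E]

/-- The increments of the kernel are tight, uniformly in the starting point. -/
def HasTightIncrements (P : Kernel E E) : Prop :=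
  ∀ δ : ℝ, 0 < δ → ∃ K : ℝ, 0 ≤ K ∧ ∀ x, (P x).real {y | K < dist y x} ≤ δ

theorem measurableSet_lt_dist (K : ℝ) (x : E) : MeasurableSet {y | K < dist y x} :=
  (isOpen_lt continuous_const (continuous_id.dist continuous_const)).measurableSet

theorem HasTightIncrements.pow {P : Kernel E E} [IsMarkovKernel P] (hP : HasTightIncrements P) :
    ∀ n : ℕ, HasTightIncrements (P ^ n)
  | 0 => fun δ hδ => ⟨0, le_rfl, fun x => by
      rw [pow_zero, show (1 : Kernel E E) x = Measure.dirac x from Kernel.id_apply x,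
        Measure.real, Measure.dirac_apply' _ (measurableSet_lt_dist 0 x)]
      simpa using hδ.le⟩
  | n + 1 => fun δ hδ => by
    obtain ⟨K₁, hK₁, h₁⟩ := hP (δ / 2) (half_pos hδ)
    obtain ⟨K₂, hK₂, h₂⟩ := hP.pow n (δ / 2) (half_pos hδ)
    refine ⟨K₁ + K₂, add_nonneg hK₁ hK₂, fun x => ?_⟩
    have := isMarkovKernel_pow P n
    have hA := measurableSet_lt_dist (K₁ + K₂) x
    have hB := measurableSet_lt_dist K₁ x
    have hA1 : Measurable ({y | K₁ + K₂ < dist y x}.indicator (1 : E → ℝ)) :=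
      measurable_one.indicator hA
    have hA2 := abs_indicator_le (f := (1 : E → ℝ)) (t := 1) (by simp) {y | K₁ + K₂ < dist y x}
    rw [← integral_indicator_one hA, integral_pow_succ P hA1 hA2]
    have hi : Integrable ({z | K₁ < dist z x}.indicator (1 : E → ℝ)) (P x) :=
      (integrable_const (1 : ℝ)).indicator hB
    calc _ ≤ ∫ z, ({z | K₁ < dist z x}.indicator (1 : E → ℝ) z + δ / 2) ∂(P x) := by
          refine integral_mono (integrable_of_abs_le (measurable_integral_kernel _ hA1)
            fun z => abs_integral_le_of_abs_le hA2)
            (hi.add (integrable_const _)) fun z => ?_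
          simp only
          rw [integral_indicator_one hA]
          by_cases hz : K₁ < dist z x
          · rw [Set.indicator_of_mem (by exact hz), Pi.one_apply]
            linarith [measureReal_le_one (μ := (P ^ n) z) (s := {y | K₁ + K₂ < dist y x})]
          · rw [Set.indicator_of_notMem (by exact hz), zero_add]
            refine (measureReal_mono fun y hy => ?_).trans (h₂ z)
            have := dist_triangle y z x
            simp only [Set.mem_ofPred_eq, not_lt] at *
            linarith
      _ ≤ δ := by
          rw [integral_add hi (integrable_const _),
            integral_indicator_one hB]
          have := h₁ x
          simp
          linarith

/-- Each step has length at most `K` with probability at least `q`, and `n` such steps cannot bring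
the chain back to the ball of radius `R`. -/
theorem survival_ge_of_tight {Q : Kernel E E} [IsMarkovKernel Q] {S : Set E}
    (hS : MeasurableSet S) {R K q : ℝ} (hK : 0 ≤ K) (hq : 0 ≤ q) (hSR : ∀ x ∈ S, ‖x‖ ≤ R)
    (hQ : ∀ x, (Q x).real {y | K < dist y x} ≤ 1 - q) :
    ∀ (n : ℕ) (x : E), R + n * K < ‖x‖ → q ^ n ≤ survival Q S n x
  | 0, x, _ => by simp [survival]
  | n + 1, x, hx => by
    have hB := measurableSet_lt_dist K x
    have hBq : q ≤ (Q x).real {y | K < dist y x}ᶜ := by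
      rw [probReal_compl_eq_one_sub hB]
      linarith [hQ x]
    calc q ^ (n + 1) ≤ (Q x).real {y | K < dist y x}ᶜ * q ^ n := by
          rw [pow_succ']
          gcongr
      _ = ∫ y, {y | K < dist y x}ᶜ.indicator (fun _ => q ^ n) y ∂(Q x) := by
          rw [integral_indicator_const _ hB.compl, smul_eq_mul]
      _ ≤ _ := by
          refine integral_mono ((integrable_const _).indicator hB.compl)
            (integrable_of_abs_le ((measurable_survival hS n).indicator hS.compl)
              (abs_indicator_le (abs_survival_le_one n) _)) fun y => ?_
          by_cases hy : K < dist y x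
          · rw [Set.indicator_of_notMem (by simpa using hy)]
            exact Set.indicator_nonneg (fun _ _ => survival_nonneg n _) _
          · rw [Set.indicator_of_mem (by simpa using hy)]
            have hyn : R + n * K < ‖y‖ := by
              have := norm_le_norm_add_norm_sub y x
              rw [← dist_eq_norm] at this
              push_cast at hx
              linarith [not_lt.1 hy]
            have hyS : y ∈ Sᶜ := fun hy' => by
              have := hSR y hy'
              nlinarith [mul_nonneg n.cast_nonneg hK]
            rw [Set.indicator_of_mem hyS]
            exact survival_ge_of_tight hS hK hq hSR hQ n y hyn

theorem measure_norm_gt_le {Q : Kernel E E} [IsMarkovKernel Q] {π : Measure E}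
    [IsProbabilityMeasure π] {S : Set E} (hS : MeasurableSet S) {R K q lam : ℝ} (hK : 0 ≤ K)
    (hq : 0 < q) (hSR : ∀ x ∈ S, ‖x‖ ≤ R) (hQ : ∀ x, (Q x).real {y | K < dist y x} ≤ 1 - q)
    (h : ∀ n, ∫ x, survival Q S n x ∂π ≤ lam ^ n) (n : ℕ) :
    π.real {x | R + n * K < ‖x‖} ≤ (lam / q) ^ n := by
  have hA : MeasurableSet {x : E | R + n * K < ‖x‖} :=
    (isOpen_lt continuous_const continuous_norm).measurableSet
  rw [div_pow, le_div_iff₀ (pow_pos hq n)]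
  refine le_trans ?_ (h n)
  rw [← smul_eq_mul, ← integral_indicator_const _ hA]
  refine integral_mono ((integrable_const _).indicator hA)
    (integrable_of_abs_le (measurable_survival hS n) (abs_survival_le_one n)) fun x => ?_
  by_cases hx : R + n * K < ‖x‖
  · rw [Set.indicator_of_mem (by exact hx)]
    exact survival_ge_of_tight hS hK hq.le hSR hQ n x hx
  · rw [Set.indicator_of_notMem (by exact hx)]
    exact survival_nonneg n x

theorem integrable_exp_norm_of_geometric_tail {π : Measure E} [IsProbabilityMeasure π] {R K r : ℝ}
    (hK : 0 < K) (hr0 : 0 < r) (hr1 : r < 1)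
    (h : ∀ n : ℕ, π.real {x | R + n * K < ‖x‖} ≤ r ^ n) :
    ∃ s : ℝ, 0 < s ∧ Integrable (fun x => Real.exp (s * ‖x‖)) π := by
  obtain ⟨s, hs, hsr⟩ : ∃ s : ℝ, 0 < s ∧ Real.exp (s * K) * r < 1 := by
    -- With this choice `exp (s * K) * r` is the square root of `r`.
    refine ⟨-Real.log r / (2 * K), div_pos (neg_pos.2 (Real.log_neg hr0 hr1)) (by linarith), ?_⟩
    nth_rw 2 [← Real.exp_log hr0]
    rw [← Real.exp_add, Real.exp_lt_one_iff]
    have := Real.log_neg hr0 hr1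
    field_simp
    linarith
  refine ⟨s, hs, ?_⟩
  have hm : Measurable fun x : E => Real.exp (s * ‖x‖) :=
    (Real.continuous_exp.comp (continuous_const.mul continuous_norm)).measurable
  have hA (n : ℕ) : MeasurableSet {x : E | R + n * K < ‖x‖} :=
    (isOpen_lt continuous_const continuous_norm).measurableSet
  refine ⟨hm.aestronglyMeasurable, ?_⟩
  rw [hasFiniteIntegral_iff_ofReal (ae_of_all _ fun x => (Real.exp_pos _).le)]
  have hpt (x : E) : ENNReal.ofReal (Real.exp (s * ‖x‖)) ≤ ENNReal.ofReal (Real.exp (s * R)) +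
      ∑' n : ℕ, {x : E | R + n * K < ‖x‖}.indicator
        (fun _ => ENNReal.ofReal (Real.exp (s * (R + (n + 1) * K)))) x := by
    by_cases hx : ‖x‖ ≤ R
    · exact le_add_right (ENNReal.ofReal_le_ofReal (Real.exp_le_exp.2 (by gcongr)))
    · push Not at hx
      obtain ⟨n, hn1, hn2⟩ : ∃ n : ℕ, R + n * K < ‖x‖ ∧ ‖x‖ ≤ R + (n + 1) * K := by
        have hpos : 0 < (‖x‖ - R) / K := div_pos (by linarith) hK
        have hceil : 0 < ⌈(‖x‖ - R) / K⌉₊ := Nat.ceil_pos.2 hpos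
        obtain ⟨n, hn⟩ := Nat.exists_eq_succ_of_ne_zero hceil.ne'
        refine ⟨n, ?_, ?_⟩
        · have := Nat.lt_ceil.1 (show n < ⌈(‖x‖ - R) / K⌉₊ by omega)
          rw [lt_div_iff₀ hK] at this
          linarith
        · have := Nat.le_ceil ((‖x‖ - R) / K)
          rw [hn, div_le_iff₀ hK] at this
          push_cast at this
          linarith
      refine le_trans ?_ (le_add_left (ENNReal.le_tsum n))
      rw [Set.indicator_of_mem (by exact hn1)]
      exact ENNReal.ofReal_le_ofReal (Real.exp_le_exp.2 (by gcongr))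
  refine (lintegral_mono hpt).trans_lt ?_
  rw [lintegral_add_left measurable_const, lintegral_const, measure_univ, mul_one,
    lintegral_tsum fun n => (measurable_const.indicator (hA n)).aemeasurable]
  refine ENNReal.add_lt_top.2 ⟨ENNReal.ofReal_lt_top, ?_⟩
  have hterm (n : ℕ) : ∫⁻ x, {x : E | R + n * K < ‖x‖}.indicator
      (fun _ => ENNReal.ofReal (Real.exp (s * (R + (n + 1) * K)))) x ∂π ≤
      ENNReal.ofReal (Real.exp (s * (R + K)) * (Real.exp (s * K) * r) ^ n) := by
    rw [lintegral_indicator_const (hA n), ← ofReal_measureReal,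
      ← ENNReal.ofReal_mul (Real.exp_pos _).le]
    refine ENNReal.ofReal_le_ofReal ?_
    calc _ ≤ Real.exp (s * (R + (n + 1) * K)) * r ^ n := by gcongr; exact h n
      _ = _ := by
        rw [mul_pow, ← Real.exp_nat_mul, ← mul_assoc, ← Real.exp_add]
        ring_nf
  refine (ENNReal.tsum_le_tsum hterm).trans_lt ?_
  have hsum : Summable fun n : ℕ => Real.exp (s * (R + K)) * (Real.exp (s * K) * r) ^ n :=
    (summable_geometric_of_lt_one (by positivity) hsr).mul_left _
  rw [← ENNReal.ofReal_tsum_of_nonneg (fun n => by positivity) hsum]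
  exact ENNReal.ofReal_lt_top

/-- `M` need not be measurable, so a sublevel set is replaced by its measurable hull. A measurable
condition valid on the sublevel set holds almost everywhere on the hull, with an exceptional set
depending on the condition. -/
theorem exists_measurable_bounded_hull {π : Measure E} [IsProbabilityMeasure π] {M : E → ℝ≥0∞}
    (hM : ∀ᵐ x ∂π, M x < ∞) : ∃ (c : ℝ≥0) (R : ℝ) (S : Set E), MeasurableSet S ∧ 0 < π.real S ∧
      (∀ x ∈ S, ‖x‖ ≤ R) ∧ ∀ T, MeasurableSet T → (∀ x, M x ≤ c → x ∈ T) → ∀ᵐ x ∂π, x ∈ S → x ∈ T := by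
  obtain ⟨n, hn⟩ : ∃ n : ℕ, π ({x | M x ≤ n} ∩ {x | ‖x‖ ≤ n}) ≠ 0 := by
    by_contra! hcon
    have h0 : π (⋃ n : ℕ, {x | M x ≤ n} ∩ {x | ‖x‖ ≤ n}) = 0 := measure_iUnion_null hcon
    have h1 : ∀ᵐ x ∂π, x ∈ ⋃ n : ℕ, {x | M x ≤ n} ∩ {x | ‖x‖ ≤ n} := by
      filter_upwards [hM] with x hx
      obtain ⟨a, ha⟩ := ENNReal.exists_nat_gt hx.ne
      obtain ⟨b, hb⟩ := exists_nat_ge ‖x‖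
      refine Set.mem_iUnion.2 ⟨max a b, ha.le.trans ?_, hb.trans ?_⟩
      · exact_mod_cast le_max_left a b
      · exact_mod_cast le_max_right a b
    obtain ⟨x, hx, hx'⟩ := (h1.and (measure_eq_zero_iff_ae_notMem.1 h0)).exists
    exact hx' hx
  have hball : MeasurableSet {x : E | ‖x‖ ≤ n} :=
    (isClosed_le continuous_norm continuous_const).measurableSet
  set A := {x | M x ≤ n} ∩ {x : E | ‖x‖ ≤ n} with hAdef
  refine ⟨n, n, toMeasurable π A ∩ {x | ‖x‖ ≤ n}, (measurableSet_toMeasurable _ _).inter hball,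
    ?_, fun x hx => hx.2, fun T hT hMT => ?_⟩
  · rw [measureReal_def, ENNReal.toReal_pos_iff]
    refine ⟨(pos_iff_ne_zero.2 hn).trans_le (measure_mono fun x hx => ⟨subset_toMeasurable _ _ hx,
      hx.2⟩), measure_lt_top _ _⟩
  · have h0 : π (toMeasurable π A ∩ Tᶜ) = 0 := by
      rw [Measure.measure_toMeasurable_inter hT.compl (measure_ne_top _ _)]
      have : A ∩ Tᶜ = ∅ := by
        ext x
        simp only [hAdef, Set.mem_inter_iff, Set.mem_ofPred_eq, Set.mem_compl_iff,
          Set.mem_empty_iff_false, iff_false, not_and, not_not]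
        exact fun hx => hMT x (by simpa using hx.1)
      rw [this, measure_empty]
    filter_upwards [measure_eq_zero_iff_ae_notMem.1 h0] with x hx hxS
    by_contra hxT
    exact hx ⟨hxS.1, hxT⟩

/-- A geometrically ergodic chain with tight increments has a limiting distribution with a finite
exponential moment. -/
theorem integrable_exp_norm_of_isGeometricallyErgodic {P : Kernel E E} [IsMarkovKernel P]
    {π : Measure E} [IsProbabilityMeasure π] (hP : HasTightIncrements P)
    (hgeo : IsGeometricallyErgodic P π) :
    ∃ s : ℝ, 0 < s ∧ Integrable (fun x => Real.exp (s * ‖x‖)) π := by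
  obtain ⟨ρ, M, hρ, hM, hgeo⟩ := hgeo
  have hinv := invariant_of_geometric hρ hM hgeo
  obtain ⟨c, R, S, hS, hSpos, hSR, hST⟩ := exists_measurable_bounded_hull hM
  have hS1 : π.real S ≤ 1 := measureReal_le_one
  have hρ' : Filter.Tendsto (fun n : ℕ => (ρ : ℝ) ^ n) Filter.atTop (nhds 0) :=
    tendsto_pow_atTop_nhds_zero_of_lt_one ρ.coe_nonneg (by exact_mod_cast hρ)
  have hcρ : Filter.Tendsto (fun n : ℕ => (c : ℝ) * (ρ : ℝ) ^ n) Filter.atTop (nhds 0) := by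
    simpa using hρ'.const_mul (c : ℝ)
  -- With `η = c * ρ ^ N` and `θ = ρ ^ N` these are the smallness conditions `8 * η ≤ π(S)` and, as
  -- `π(S) ≤ 1`, `4 * (η + θ) ≤ 1`.
  obtain ⟨N, hN1, hN2⟩ := ((hρ'.eventually_lt_const (show (0 : ℝ) < 1 / 8 by norm_num)).and
    (hcρ.eventually_lt_const (show 0 < π.real S / 8 by linarith))).exists
  have hQm := isMarkovKernel_pow P N
  have hsurv := integral_survival_le (Q := P ^ N) (invariant_pow hinv N) hS
    (η := c * (ρ : ℝ) ^ N) (θ := (ρ : ℝ) ^ N) (by positivity) (by positivity) (by linarith)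
    (by linarith) fun f t hf ht k => by
      have := isMarkovKernel_pow (P ^ N) (k + 1)
      refine hST {x | |∫ y, f y ∂(((P ^ N) ^ (k + 1)) x) - ∫ y, f y ∂π| ≤
        c * (ρ : ℝ) ^ N * ((ρ : ℝ) ^ N) ^ k * t}
        (measurableSet_le ((measurable_integral_kernel _ hf).sub_const _).abs measurable_const)
        fun x hx => ?_
      have h := abs_integral_sub_le_of_tvDist_le (by positivity)
        (tvDist_le_ofReal hgeo hx (N * (k + 1))) hf ((abs_nonneg _).trans (ht x)) ht
      rw [pow_mul] at h
      refine h.trans_eq ?_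
      ring
  obtain ⟨K, hK, hQ⟩ := hP.pow N (π.real S / 4) (by linarith)
  -- `K` may vanish, so `K + 1` serves as the positive step length.
  refine integrable_exp_norm_of_geometric_tail (R := R) (K := K + 1)
    (r := (1 - π.real S / 2) / (1 - π.real S / 4)) (by linarith)
    (div_pos (by linarith) (by linarith)) ((div_lt_one (by linarith)).2 (by linarith)) ?_
  refine measure_norm_gt_le hS (by linarith) (by linarith) hSR (fun x => ?_) hsurv
  rw [sub_sub_cancel]
  refine (measureReal_mono fun y hy => ?_).trans (hQ x)
  simp only [Set.mem_ofPred_eq] at hy ⊢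
  linarith

end ExponentialMoment

/-! ### Increments of HMC under a bounded gradient -/

section Increments

variable {d : ℕ} {U : Space d → ℝ}

/-- A rejected proposal does not move, and an accepted one moves by at most `b θ`. The law of `b θ`
is the same for all `x`, and its tails tend to zero because it is finite. -/
theorem hasTightIncrements_hmcKernel (hU : Measurable U) {Φ : ℕ → Phase d → Phase d}
    (hΦ : ∀ L, Measurable (Φ L)) (𝔏 : Measure ℕ) [IsProbabilityMeasure 𝔏]
    {b : Space d × ℕ × ℝ → ℝ} (hb : Measurable b)
    (hΦb : ∀ x θ, ‖(Φ θ.2.1 (x, θ.1)).1 - x‖ ≤ b θ) :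
    HasTightIncrements (hmcKernel U Φ 𝔏) := by
  intro δ hδ
  have hA (n : ℕ) : MeasurableSet {θ | (n : ℝ) < b θ} := measurableSet_lt measurable_const hb
  have hanti : Antitone fun n : ℕ => {θ | (n : ℝ) < b θ} := by
    intro m n hmn θ hθ
    have hθ' : (n : ℝ) < b θ := hθ
    exact (Nat.cast_le.2 hmn).trans_lt hθ'
  have hempty : ⋂ n : ℕ, {θ | (n : ℝ) < b θ} = ∅ := by
    refine Set.eq_empty_of_forall_notMem fun θ hθ => ?_
    obtain ⟨n, hn⟩ := exists_nat_ge (b θ)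
    exact (Set.mem_iInter.1 hθ n).not_ge hn
  have hlim := tendsto_measure_iInter_atTop (μ := drawLaw d 𝔏)
    (fun n => (hA n).nullMeasurableSet) hanti ⟨0, measure_ne_top _ _⟩
  rw [hempty, measure_empty] at hlim
  obtain ⟨n, hn⟩ := (hlim.eventually_lt_const (ENNReal.ofReal_pos.2 hδ)).exists
  refine ⟨n, n.cast_nonneg, fun x => ?_⟩
  have hstep : Measurable (hmcStep U Φ x) := (measurable_hmcStep hU hΦ).comp measurable_prodMk_left
  rw [hmcKernel_apply hU hΦ, map_measureReal_apply hstep (measurableSet_lt_dist _ _)]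
  refine (measureReal_mono fun θ hθ => ?_).trans (ENNReal.toReal_le_of_le_ofReal hδ.le hn.le)
  have hθ' : (n : ℝ) < dist (hmcStep U Φ x θ) x := hθ
  rw [hmcStep] at hθ'
  split_ifs at hθ'
  · rw [dist_eq_norm] at hθ'
    exact hθ'.trans_le (hΦb x θ)
  · rw [dist_self] at hθ'
    exact absurd hθ' n.cast_nonneg.not_gt

theorem norm_leapfrogStep_le {M ε : ℝ} (hM : ∀ x, ‖gradient U x‖ ≤ M) (hε : 0 ≤ ε) (z : Phase d) :
    ‖(leapfrogStep U ε z).2‖ ≤ ‖z.2‖ + ε * M ∧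
      ‖(leapfrogStep U ε z).1 - z.1‖ ≤ ε * (‖z.2‖ + ε * M) := by
  have hM0 : 0 ≤ M := (norm_nonneg _).trans (hM 0)
  have hg (x : Space d) : ‖(ε / 2) • gradient U x‖ ≤ ε / 2 * M := by
    rw [norm_smul, Real.norm_of_nonneg (by positivity)]
    gcongr
    exact hM x
  have hp : ‖z.2 - (ε / 2) • gradient U z.1‖ ≤ ‖z.2‖ + ε / 2 * M :=
    (norm_sub_le _ _).trans (by gcongr; exact hg _)
  refine ⟨?_, ?_⟩
  · refine (norm_sub_le _ _).trans ((add_le_add hp (hg _)).trans_eq ?_)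
    ring
  · rw [leapfrogStep, add_sub_cancel_left, norm_smul, Real.norm_of_nonneg hε]
    gcongr
    -- The half kick gives `ε / 2 * M`; it is relaxed to `ε * M` so that leapfrog and exact flow
    -- satisfy a bound of one form.
    refine hp.trans ?_
    nlinarith [mul_nonneg hε hM0]

theorem norm_leapfrog_le {M ε : ℝ} (hM : ∀ x, ‖gradient U x‖ ≤ M) (hε : 0 ≤ ε) (z : Phase d) :
    ∀ L : ℕ, ‖(leapfrog U ε L z).2‖ ≤ ‖z.2‖ + L * ε * M ∧
      ‖(leapfrog U ε L z).1 - z.1‖ ≤ L * ε * (‖z.2‖ + L * ε * M)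
  | 0 => by simp [leapfrog]
  | L + 1 => by
    have hM0 : 0 ≤ M := (norm_nonneg _).trans (hM 0)
    obtain ⟨h1, h2⟩ := norm_leapfrog_le hM hε z L
    have hs : leapfrog U ε (L + 1) z = leapfrogStep U ε (leapfrog U ε L z) :=
      Function.iterate_succ_apply' _ _ _
    rw [hs]
    obtain ⟨h3, h4⟩ := norm_leapfrogStep_le hM hε (leapfrog U ε L z)
    push_cast
    refine ⟨by linarith, ?_⟩
    have h5 := norm_sub_le_norm_sub_add_norm_sub (leapfrogStep U ε (leapfrog U ε L z)).1
      (leapfrog U ε L z).1 z.1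
    have h6 := mul_le_mul_of_nonneg_left h1 hε
    have h7 : 0 ≤ (L : ℝ) * (ε * (ε * M)) := by positivity
    linarith

/-- Mean value inequality twice: the force bounds the drift of the momentum, and the momentum is the
velocity. -/
theorem norm_flow_sub_le {M : ℝ} (hM : ∀ x, ‖gradient U x‖ ≤ M) {φ : ℝ → Phase d → Phase d}
    (hφ : IsHamiltonianFlow U φ) {t : ℝ} (ht : 0 ≤ t) (z : Phase d) :
    ‖(φ t z).1 - z.1‖ ≤ t * (‖z.2‖ + t * M) := by
  have hM0 : 0 ≤ M := (norm_nonneg _).trans (hM 0)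
  have hp : ∀ r ∈ Set.Icc 0 t, ‖(φ r z).2 - z.2‖ ≤ M * (r - 0) := by
    have h := norm_image_sub_le_of_norm_deriv_le_segment' (a := 0) (b := t)
      (f := fun r => (φ r z).2) (fun r _ => (hφ.solves z r).2.hasDerivWithinAt)
      (fun r _ => by rw [norm_neg]; exact hM _)
    simpa only [hφ.init] using h
  have hx := norm_image_sub_le_of_norm_deriv_le_segment' (f := fun r => (φ r z).1)
    (C := ‖z.2‖ + t * M) (fun r _ => (hφ.solves z r).1.hasDerivWithinAt)
    (fun r hr => by
      have h1 := hp r ⟨hr.1, hr.2.le⟩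
      have h2 := norm_le_norm_add_norm_sub' (φ r z).2 z.2
      have h3 := mul_le_mul_of_nonneg_left hr.2.le hM0
      linarith) t ⟨ht, le_rfl⟩
  simp only [hφ.init] at hx
  linarith

theorem exists_integrable_exp_norm_target (hU : Measurable U)
    (hint : Integrable (fun x => Real.exp (-U x)) volume) {Φ : ℕ → Phase d → Phase d}
    (hΦ : ∀ L, Measurable (Φ L)) (𝔏 : Measure ℕ) [IsProbabilityMeasure 𝔏] {ε M : ℝ}
    (hb : ∀ (L : ℕ) z, ‖(Φ L z).1 - z.1‖ ≤ L * ε * (‖z.2‖ + L * ε * M))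
    (hgeo : IsGeometricallyErgodic (hmcKernel U Φ 𝔏) (target U)) :
    ∃ s : ℝ, 0 < s ∧ Integrable (fun x => Real.exp (s * ‖x‖)) (target U) := by
  have : IsProbabilityMeasure (target U) := isProbabilityMeasure_tilted hint
  have := isMarkovKernel_hmcKernel hU hΦ 𝔏
  refine integrable_exp_norm_of_isGeometricallyErgodic
    (hasTightIncrements_hmcKernel hU hΦ 𝔏
      (b := fun θ => θ.2.1 * ε * (‖θ.1‖ + θ.2.1 * ε * M)) ?_ fun x θ => hb θ.2.1 (x, θ.1)) hgeo
  have hL : Measurable fun θ : Space d × ℕ × ℝ => (θ.2.1 : ℝ) :=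
    (measurable_of_countable (fun n : ℕ => (n : ℝ))).comp (by fun_prop)
  fun_prop

end Increments

end HMC

end

theorem mainTheorem4 (d : ℕ) (U : HMC.Space d → ℝ) (hU : Differentiable ℝ U)
    (hint : Integrable (fun x => Real.exp (-U x)) volume)
    (M : ℝ) (hM : ∀ x, ‖gradient U x‖ < M)
    (𝔏 : Measure ℕ) [IsProbabilityMeasure 𝔏] (ε : ℝ) (hε : 0 ≤ ε) :
    (HMC.IsGeometricallyErgodic (HMC.hmcKernel U (HMC.leapfrog U ε) 𝔏) (HMC.target U) →
      ∃ s : ℝ, 0 < s ∧ Integrable (fun x => Real.exp (s * ‖x‖)) (HMC.target U)) ∧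
    (∀ φ : ℝ → HMC.Phase d → HMC.Phase d,
      ContDiff ℝ 1 U → HMC.IsHamiltonianFlow U φ → (∀ t, Measurable (φ t)) →
      HMC.IsGeometricallyErgodic (HMC.hmcKernel U (fun L => φ (L * ε)) 𝔏) (HMC.target U) →
      ∃ s : ℝ, 0 < s ∧ Integrable (fun x => Real.exp (s * ‖x‖)) (HMC.target U)) := by
  have hUm : Measurable U := hU.continuous.measurable
  refine ⟨fun hgeo => ?_, fun φ _ hφ hφm hgeo => ?_⟩
  · exact HMC.exists_integrable_exp_norm_target hUm hint (HMC.measurable_leapfrog U ε) 𝔏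
      (fun L z => (HMC.norm_leapfrog_le (fun x => (hM x).le) hε z L).2) hgeo
  · exact HMC.exists_integrable_exp_norm_target hUm hint (fun L => hφm _) 𝔏
      (fun L z => HMC.norm_flow_sub_le (fun x => (hM x).le) hφ (by positivity) z) hgeo
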